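/- Let $n\ge 1$, $d=2^n$, and let $\mathrm{Cl}_n\subset U(d)$ be the $n$-qubit Clifford group, i.e. the subgroup generated by the Hadamard gates, the phase gates $\mathrm{diag}(1,i)$ and the gates $\mathrm{CNOT}_{i,j}$ (control $i$, target $j\neq i$) on $n$ qubits. For operators $A,B$ on $(\mathbb C^2)^{\otimes n}$ let $(A|B)=\mathrm{Tr}(A^\dagger B)$ and let $|A)(B|$ be the superoperator $C\mapsto (B|C)\,A$; for $g\in U(d)$ let $\omega(g)(A)=gAg^\dagger$, with adjoint $\omega(g)^\dagger(A)=g^\dagger A g$. For $a\in\mathbb F_2^{2n}$ let $\sigma_a=\sigma_{a_1}\otimes\dots\otimes\sigma_{a_n}$ be the Pauli operators, where $\sigma_{00}=\mathbb 1$, $\sigma_{01}=X$, $\sigma_{11}=Y$, $\sigma_{10}=Z$; write $\hat A=A/\sqrt d$ and $Z_1=Z\otimes\mathbb 1^{\otimes (n-1)}$. Let $M=\sum_{x\in\mathbb F_2^n}|E_x)(E_x|$ with $E_x=|x\rangle\langle x|$. Let $$\mathcal N=\{\mathbb 1\}\cup\bigcup_{i=1}^{n-1}\Big\{U^{(1)}_{2,1}U^{(2)}_{3,2}\cdots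 U^{(i)}_{i+1,i}\ :\ U^{(1)},\dots,U^{(i)}\in\{\mathrm{SWAP},\mathrm{CNOT}\}\Big\}\subset \mathrm{Cl}_n ,$$ $$\mathrm{St}_{e_1}=\{g\in\mathrm{Cl}_n : \omega(g)^\dagger\,|Z_1)(Z_1|\,\omega(g)=|Z_1)(Z_1|\}.$$ Then $\mathrm{Cl}_n$ is finite, and for every $a\neq 0$ there is $g_a\in\mathrm{Cl}_n$ with $\omega(g_a)^\dagger|Z_1)(Z_1|\omega(g_a)=|\sigma_a)(\sigma_a|$. Moreover, let $g\mapsto\Lambda(g)$ be any map from $\mathrm{Cl}_n$ to the quantum channels (completely positive trace-preserving maps) on $n$ qubits. Then for every choice of such elements $g_a$, $a\ne 0$, the noisy frame operator for uniform sampling from $\mathrm{Cl}_n$, $$\tilde S=\mathbb E_{g\in\mathrm{Cl}_n}\big[\omega(g)^\dagger M\,\omega(g)\,\Lambda(g)\big],$$ satisfies $$\tilde S=|\hat{\mathbb 1})(\hat{\mathbb 1}|+\frac1{d+1}\sum_{a\in\mathbb F_2^{2n}\setminus\{0\}}|\hat\sigma_a)(\hat\sigma_a|\;\mathbb E_{h\in\mathcal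 N}\,\mathbb E_{h'\in\mathrm{St}_{e_1}}\Lambda(h^{-1}h'g_a),$$ where all expectations are uniform averages over the indicated finite sets. -/

import Mathlib

open scoped Matrix ComplexOrder

namespace CliffordShadow

noncomputable section

/-- Labels of the computational basis of `n` qubits: bit strings `x ∈ 𝔽₂ⁿ`
(addition in `Fin 2` is addition modulo 2). -/
abbrev Bits (n : ℕ) : Type := Fin n → Fin 2

/-- Linear operators on the Hilbert space `(ℂ²)^{⊗ n}`, written in the computational basis. -/
abbrev Op (n : ℕ) : Type := Matrix (Bits n) (Bits n) ℂ

/-- Superoperators: linear maps from operators to operators; `*` is composition. -/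
abbrev SuperOp (n : ℕ) : Type := Module.End ℂ (Op n)

/-- The unitary group `U(d)`, `d = 2ⁿ`. -/
abbrev UGroup (n : ℕ) : Type := Matrix.unitaryGroup (Bits n) ℂ

/-- The tensor product `A₁ ⊗ ⋯ ⊗ Aₙ` of one-qubit operators. -/
def tensor {n : ℕ} (A : Fin n → Matrix (Fin 2) (Fin 2) ℂ) : Op n :=
  Matrix.of fun x y => ∏ i, A i (x i) (y i)

lemma tensor_mul {n : ℕ} (A B : Fin n → Matrix (Fin 2) (Fin 2) ℂ) :
    tensor A * tensor B = tensor (fun i => A i * B i) := by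
  ext x y
  simp only [tensor, Matrix.mul_apply, Matrix.of_apply, ← Finset.prod_mul_distrib]
  rw [Finset.prod_univ_sum, Fintype.piFinset_univ]

lemma tensor_one {n : ℕ} : tensor (fun _ : Fin n => 1) = 1 := by
  ext x y
  simp only [tensor, Matrix.of_apply, Matrix.one_apply]
  by_cases h : x = y
  · subst h; simp
  · obtain ⟨i, hi⟩ := Function.ne_iff.mp h
    rw [if_neg h]
    exact Finset.prod_eq_zero (Finset.mem_univ i) (by simp [hi])

lemma tensor_conjTranspose {n : ℕ} (A : Fin n → Matrix (Fin 2) (Fin 2) ℂ) :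
    (tensor A)ᴴ = tensor (fun i => (A i)ᴴ) := by
  ext x y
  simp [tensor, Matrix.conjTranspose_apply]

/-! ### Pauli operators -/

/-- The one-qubit Pauli operators, with labels `00 ↦ 1`, `01 ↦ X`, `11 ↦ Y`, `10 ↦ Z`. -/
def pauli₁ : Fin 2 × Fin 2 → Matrix (Fin 2) (Fin 2) ℂ
  | (0, 0) => 1
  | (0, 1) => !![0, 1; 1, 0]
  | (1, 1) => !![0, -Complex.I; Complex.I, 0]
  | (1, 0) => !![1, 0; 0, -1]

/-- Labels `a = (a₁, …, aₙ) ∈ 𝔽₂²ⁿ`, `aᵢ ∈ 𝔽₂²`, of the Pauli operators. -/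
abbrev PauliLabel (n : ℕ) : Type := Fin n → Fin 2 × Fin 2

/-- The Pauli operator `σ_a = σ_{a₁} ⊗ ⋯ ⊗ σ_{aₙ}`. -/
def pauli {n : ℕ} (a : PauliLabel n) : Op n := tensor fun i => pauli₁ (a i)

/-- The diagonal Pauli operator `Z_z = Z^{z₁} ⊗ ⋯ ⊗ Z^{zₙ}`, `z ∈ 𝔽₂ⁿ`. -/
def pauliZ {n : ℕ} (z : Bits n) : Op n := tensor fun i => pauli₁ (1, 0) ^ (z i : ℕ)

/-- `Z₁ = Z ⊗ 1 ⊗ ⋯ ⊗ 1`: the operator `Z_{e₁}` (the first qubit has index `0 : Fin n`). -/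
def Z₁ (n : ℕ) [NeZero n] : Op n := pauliZ (Pi.single 0 1)

/-- Normalization `Â = A / √d`, `d = 2ⁿ`. -/
def normalized {n : ℕ} (A : Op n) : Op n := ((Real.sqrt ((2 : ℝ) ^ n) : ℝ) : ℂ)⁻¹ • A

/-! ### Superoperators -/

/-- The Hilbert–Schmidt inner product `(A|B) = Tr(A† B)`. -/
def hsInner {n : ℕ} (A B : Op n) : ℂ := (Aᴴ * B).trace

/-- The superoperator `|A)(B| : C ↦ (B|C) A`. -/
def ketbra {n : ℕ} (A B : Op n) : SuperOp n where
  toFun C := hsInner B C • A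
  map_add' C D := by simp [hsInner, mul_add, add_smul]
  map_smul' c C := by simp [hsInner, mul_smul]

/-- The unitary channel `ω(g) : A ↦ g A g†`. -/
def ω {n : ℕ} (g : UGroup n) : SuperOp n where
  toFun A := (g : Op n) * A * (g : Op n)ᴴ
  map_add' A B := by simp [mul_add, add_mul]
  map_smul' c A := by simp

/-- The adjoint `ω(g)† : A ↦ g† A g` of `ω(g)`; see `hsInner_ω`. -/
def ωAdj {n : ℕ} (g : UGroup n) : SuperOp n where
  toFun A := (g : Op n)ᴴ * A * (g : Op n)
  map_add' A B := by simp [mul_add, add_mul]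
  map_smul' c A := by simp

/-- `ω(g)†` is the adjoint of `ω(g)` for the Hilbert–Schmidt inner product. -/
lemma hsInner_ω {n : ℕ} (g : UGroup n) (A B : Op n) :
    hsInner A (ω g B) = hsInner (ωAdj g A) B := by
  simp only [hsInner, ω, ωAdj, LinearMap.coe_mk, AddHom.coe_mk, Matrix.conjTranspose_mul,
    Matrix.conjTranspose_conjTranspose]
  rw [← mul_assoc, Matrix.trace_mul_comm]
  simp only [mul_assoc]

/-- `id_k ⊗ Φ` applied to an operator on `ℂᵏ ⊗ (ℂ²)^{⊗ n}`. -/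
def ampliate {n : ℕ} (k : ℕ) (Φ : SuperOp n) (X : Matrix (Fin k × Bits n) (Fin k × Bits n) ℂ) :
    Matrix (Fin k × Bits n) (Fin k × Bits n) ℂ :=
  Matrix.of fun p q => Φ (Matrix.of fun x y => X (p.1, x) (q.1, y)) p.2 q.2

/-- Quantum channels: completely positive and trace-preserving linear maps. -/
structure IsChannel {n : ℕ} (Φ : SuperOp n) : Prop where
  completelyPositive : ∀ (k : ℕ) (X : Matrix (Fin k × Bits n) (Fin k × Bits n) ℂ),
    X.PosSemidef → (ampliate k Φ X).PosSemidef
  tracePreserving : ∀ A : Op n, (Φ A).trace = A.trace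

/-! ### Gates and the Clifford group -/

/-- The Hadamard gate. -/
def hadamard : Matrix (Fin 2) (Fin 2) ℂ := ((Real.sqrt 2 : ℝ) : ℂ)⁻¹ • !![1, 1; 1, -1]

/-- The phase gate. -/
def phase : Matrix (Fin 2) (Fin 2) ℂ := !![1, 0; 0, Complex.I]

lemma hadamard_mem : hadamard ∈ Matrix.unitaryGroup (Fin 2) ℂ := by
  have h : (((Real.sqrt 2 : ℝ) : ℂ)⁻¹) * (((Real.sqrt 2 : ℝ) : ℂ)⁻¹) = 1 / 2 := by
    rw [← mul_inv, ← Complex.ofReal_mul, Real.mul_self_sqrt (by norm_num)]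
    norm_num
  rw [Matrix.mem_unitaryGroup_iff]
  ext i j
  fin_cases i <;> fin_cases j <;>
    simp [hadamard, Matrix.mul_apply, Matrix.star_apply, h] <;> norm_num

lemma phase_mem : phase ∈ Matrix.unitaryGroup (Fin 2) ℂ := by
  rw [Matrix.mem_unitaryGroup_iff]
  ext i j
  fin_cases i <;> fin_cases j <;> simp [phase, Matrix.mul_apply, Matrix.star_apply]

/-- The one-qubit unitary `U` acting on qubit `i`: `1 ⊗ ⋯ ⊗ U ⊗ ⋯ ⊗ 1`. -/
def onQubit {n : ℕ} (i : Fin n) (U : Matrix.unitaryGroup (Fin 2) ℂ) : UGroup n :=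
  ⟨tensor (Function.update (fun _ => 1) i (U : Matrix (Fin 2) (Fin 2) ℂ)), by
    rw [Matrix.mem_unitaryGroup_iff, Matrix.star_eq_conjTranspose, tensor_conjTranspose,
      tensor_mul, ← tensor_one]
    congr 1
    funext j
    by_cases h : j = i
    · subst h
      simpa [Matrix.star_eq_conjTranspose] using Matrix.mem_unitaryGroup_iff.mp U.2
    · simp [h]⟩

/-- The unitary `|x⟩ ↦ |f x⟩` given by an involution `f` of the computational basis. -/
def involutionGate {n : ℕ} (f : Bits n → Bits n) (hf : Function.Involutive f) : UGroup n :=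
  ⟨Matrix.of fun x y => if x = f y then 1 else 0, by
    rw [Matrix.mem_unitaryGroup_iff]
    ext x y
    simp only [Matrix.mul_apply, Matrix.star_apply, Matrix.of_apply, Matrix.one_apply]
    rw [Finset.sum_eq_single (f x)]
    · by_cases h : x = y
      · subst h; simp [hf x]
      · simp [hf x, h, Ne.symm h]
    · intro z _ hz
      have : x ≠ f z := fun h => hz (by rw [h, hf z])
      simp [this]
    · simp⟩

/-- `CNOT` with control qubit `i` and target qubit `j` on basis labels:
`x_j ↦ x_j + x_i`. -/
def cnotFun {n : ℕ} (i j : Fin n) (x : Bits n) : Bits n := Function.update x j (x j + x i)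

lemma cnotFun_involutive {n : ℕ} {i j : Fin n} (h : i ≠ j) :
    Function.Involutive (cnotFun i j) := by
  intro x
  funext k
  have key : ∀ a b : Fin 2, a + b + b = a := by decide
  by_cases hk : k = j
  · subst hk; simp [cnotFun, h, key]
  · simp [cnotFun, hk]

/-- The gate `CNOT_{i,j}` with control qubit `i` and target qubit `j`. -/
def cnotGate {n : ℕ} (i j : Fin n) (h : i ≠ j) : UGroup n :=
  involutionGate (cnotFun i j) (cnotFun_involutive h)

/-- `SWAP_{i,j}` on basis labels: the bits `x_i` and `x_j` are exchanged. -/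
def swapFun {n : ℕ} (i j : Fin n) (x : Bits n) : Bits n := fun k => x (Equiv.swap i j k)

lemma swapFun_involutive {n : ℕ} (i j : Fin n) : Function.Involutive (swapFun i j) := by
  intro x
  funext k
  simp [swapFun]

/-- The gate `SWAP_{i,j}`. -/
def swapGate {n : ℕ} (i j : Fin n) : UGroup n :=
  involutionGate (swapFun i j) (swapFun_involutive i j)

/-- The `n`-qubit Clifford group: the subgroup of `U(2ⁿ)` generated by the Hadamard and phase gates
on all qubits and the `CNOT` gates on all ordered pairs of distinct qubits. -/
def Clifford (n : ℕ) : Subgroup (UGroup n) :=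
  Subgroup.closure
    ({U | ∃ i, U = onQubit i ⟨hadamard, hadamard_mem⟩} ∪
      {U | ∃ i, U = onQubit i ⟨phase, phase_mem⟩} ∪
      {U | ∃ i j, ∃ h : i ≠ j, U = cnotGate i j h})

lemma cnotGate_mem {n : ℕ} {i j : Fin n} (h : i ≠ j) : cnotGate i j h ∈ Clifford n :=
  Subgroup.subset_closure (Or.inr ⟨i, j, h, rfl⟩)

/-- `SWAP_{i,j} = CNOT_{i,j} CNOT_{j,i} CNOT_{i,j}`. -/
lemma swapGate_eq {n : ℕ} {i j : Fin n} (h : i ≠ j) :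
    swapGate i j = cnotGate i j h * cnotGate j i h.symm * cnotGate i j h := by
  have key : ∀ x : Bits n, swapFun i j x = cnotFun i j (cnotFun j i (cnotFun i j x)) := by
    intro x
    funext k
    have h1 : ∀ a b : Fin 2, a + (b + a) = b := by decide
    have h2 : ∀ a b : Fin 2, b + a + (a + (b + a)) = a := by decide
    by_cases hj : k = j
    · subst hj; simp [cnotFun, swapFun, h, h.symm, h2]
    · by_cases hi : k = i
      · subst hi; simp [cnotFun, swapFun, h, h.symm, h1]
      · simp [cnotFun, swapFun, hi, hj, Equiv.swap_apply_of_ne_of_ne]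
  apply Subtype.ext
  ext x y
  simp [swapGate, cnotGate, involutionGate, Matrix.mul_apply, key]

lemma swapGate_mem {n : ℕ} {i j : Fin n} (h : i ≠ j) : swapGate i j ∈ Clifford n := by
  rw [swapGate_eq h]
  exact mul_mem (mul_mem (cnotGate_mem h) (cnotGate_mem h.symm)) (cnotGate_mem h)

/-- One of the two gates `U_{i,j}`, `U ∈ {SWAP, CNOT}`, as an element of the Clifford group. -/
def pairGate {n : ℕ} (isCnot : Bool) (i j : Fin n) (h : i ≠ j) : Clifford n :=
  if isCnot then ⟨cnotGate i j h, cnotGate_mem h⟩ else ⟨swapGate i j, swapGate_mem h⟩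

/-- The ordered product `U⁽¹⁾_{2,1} U⁽²⁾_{3,2} ⋯ U⁽ⁱ⁾_{i+1,i}` (leftmost factor first), in which each
`U⁽ʲ⁾` is chosen independently from `{SWAP, CNOT}`. Qubits are counted from `0` here. -/
def chain {n : ℕ} (i : ℕ) (hi : i < n) (isCnot : Fin i → Bool) : Clifford n :=
  (List.ofFn fun j : Fin i =>
    pairGate (isCnot j) ⟨j + 1, by omega⟩ ⟨j, by omega⟩
      (by simp [Fin.ext_iff])).prod

/-- The set `𝒩 = {1} ∪ ⋃_{i=1}^{n-1} { ∏_{j=1}^{i} U⁽ʲ⁾_{j+1,j} | U⁽ʲ⁾ ∈ {SWAP, CNOT} }`. -/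
def 𝒩 (n : ℕ) : Set (Clifford n) :=
  {1} ∪ {h | ∃ (i : ℕ) (_ : 1 ≤ i) (hi : i < n) (isCnot : Fin i → Bool), h = chain i hi isCnot}

/-- The stabilizer `St_{e₁} = {g ∈ Cl_n | ω(g)† |Z₁)(Z₁| ω(g) = |Z₁)(Z₁|}`. -/
def St (n : ℕ) [NeZero n] : Set (Clifford n) :=
  {g | ωAdj (g : UGroup n) * ketbra (Z₁ n) (Z₁ n) * ω (g : UGroup n) = ketbra (Z₁ n) (Z₁ n)}

/-! ### The noisy frame operator -/

/-- The uniform average `𝔼_{x ∈ α} f x` over a finite non-empty type `α`. -/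
def avg {α : Type*} {V : Type*} [AddCommGroup V] [Module ℂ V] (f : α → V) : V :=
  (Nat.card α : ℂ)⁻¹ • ∑ᶠ x, f x

/-- The measure-and-prepare channel `M = ∑_x |E_x)(E_x|`, `E_x = |x⟩⟨x|`, of the measurement in the
computational basis. -/
def measurement (n : ℕ) : SuperOp n :=
  ∑ x : Bits n, ketbra (Matrix.single x x 1) (Matrix.single x x 1)

/-- The noisy frame operator `𝔼_{g ∈ Cl_n} [ω(g)† M ω(g) Λ(g)]` for uniform sampling from the
`n`-qubit Clifford group with noise `Λ(g)`. -/
def noisyFrameOperator {n : ℕ} (Λ : Clifford n → SuperOp n) : SuperOp n :=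
  avg fun g : Clifford n => ωAdj (g : UGroup n) * measurement n * ω (g : UGroup n) * Λ g

end

end CliffordShadow

open CliffordShadow

namespace CliffordShadow

variable {n : ℕ}

/-! ### Conjugation by unitaries -/

/-! The measurement channel is dephasing, and a character expansion gives `M = 2⁻ⁿ ∑_z |Z_z)(Z_z|`
(`measurement_eq`). The term `z = 0` is `|1)(1|`, which is fixed by Clifford conjugation and absorbs
`Λ(g)` on its right because channels preserve the trace; this is the first summand of the formula.

For `z ≠ 0` there is exactly one `h ∈ 𝒩` with `h† Z₁ h = Z_z` (`exists_equiv_𝒩`), so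
`ω(g)†|Z_z)(Z_z|ω(g)` is `|Z₁)(Z₁|` conjugated by `hg`. After the substitution `g ↦ h⁻¹g`, the group
is cut into right cosets of `St_{e₁}`. Clifford conjugation permutes the nonidentity Paulis
transitively up to phase, so the `g_a` with `a ≠ 0` represent these cosets
(`bijective_mul_representative`), and on the coset of `g_a` the conjugated projector is constantly
`|σ_a)(σ_a|`. The prefactor follows from `|Cl_n| = (4ⁿ - 1)|St_{e₁}|` and `|𝒩| = 2ⁿ - 1`.

Finiteness of `Cl_n`: it acts on the finite set of phased Paulis, and two elements acting alike
differ by a scalar, which the determinant confines to roots of unity. -/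

lemma ω_apply (g : UGroup n) (A : Op n) : ω g A = (g : Op n) * A * (g : Op n)ᴴ := rfl

lemma ωAdj_apply (g : UGroup n) (A : Op n) : ωAdj g A = (g : Op n)ᴴ * A * (g : Op n) := rfl

lemma ketbra_apply (A B C : Op n) : ketbra A B C = hsInner B C • A := rfl

lemma UGroup.mul_conjTranspose (g : UGroup n) : (g : Op n) * (g : Op n)ᴴ = 1 :=
  Matrix.mem_unitaryGroup_iff.mp g.2

lemma UGroup.conjTranspose_mul (g : UGroup n) : (g : Op n)ᴴ * (g : Op n) = 1 :=
  Matrix.mem_unitaryGroup_iff'.mp g.2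

lemma ω_inv (g : UGroup n) : ω g⁻¹ = ωAdj g := by
  ext1 A
  simp [ω_apply, ωAdj_apply, Matrix.star_eq_conjTranspose]

lemma ω_mul_apply (g h : UGroup n) (A : Op n) : ω (g * h) A = ω g (ω h A) := by
  simp [ω_apply, mul_assoc]

lemma ωAdj_mul_apply (g h : UGroup n) (A : Op n) : ωAdj (g * h) A = ωAdj h (ωAdj g A) := by
  simp [ωAdj_apply, mul_assoc]

lemma ω_ωAdj (g : UGroup n) (A : Op n) : ω g (ωAdj g A) = A := by
  have h := UGroup.mul_conjTranspose g
  simp only [ω_apply, ωAdj_apply, ← mul_assoc, h, one_mul]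
  rw [mul_assoc, h, mul_one]

lemma ωAdj_ω (g : UGroup n) (A : Op n) : ωAdj g (ω g A) = A := by
  have h := UGroup.conjTranspose_mul g
  simp only [ω_apply, ωAdj_apply, ← mul_assoc, h, one_mul]
  rw [mul_assoc, h, mul_one]

lemma ωAdj_mul_ketbra_mul_ω (g : UGroup n) (A B : Op n) :
    ωAdj g * ketbra A B * ω g = ketbra (ωAdj g A) (ωAdj g B) := by
  ext1 C
  simp [ketbra_apply, hsInner_ω]

lemma ketbra_smul (c : ℂ) (A : Op n) :
    ketbra (c • A) (c • A) = (c * star c) • ketbra A A := by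
  ext1 C
  simp only [ketbra_apply, hsInner, Matrix.conjTranspose_smul, Matrix.smul_mul, Matrix.trace_smul,
    smul_eq_mul, LinearMap.smul_apply, smul_smul]
  congr 1
  ring

lemma mul_star_of_pow_four {c : ℂ} (hc : c ^ 4 = 1) : c * star c = 1 := by
  have h : ‖c‖ = 1 := Complex.norm_eq_one_of_pow_eq_one hc (by norm_num)
  rw [Complex.star_def, Complex.mul_conj, Complex.normSq_eq_norm_sq, h]
  norm_num

/-- The phases that Paulis acquire under Clifford conjugation have modulus one, so they are
invisible to `|A)(A|`. Hence only Pauli labels need tracking from here on. -/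
lemma ketbra_phase {c : ℂ} (hc : c ^ 4 = 1) (A : Op n) :
    ketbra (c • A) (c • A) = ketbra A A := by
  rw [ketbra_smul, mul_star_of_pow_four hc, one_smul]

/-! ### Entries of the Pauli operators -/

/-- The character `(-1)^{z · x}`. -/
noncomputable def sgn (z x : Bits n) : ℂ := ∏ i, (-1) ^ ((z i : ℕ) * (x i : ℕ))

lemma sgn_comm (z x : Bits n) : sgn z x = sgn x z := by
  simp [sgn, mul_comm]

/-- This encodes `σ_{zb} = i^{zb} X^b Z^z`: a bit flip by `b` after the character `(-1)^{zy}`. -/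
lemma pauli₁_apply (p : Fin 2 × Fin 2) (x y : Fin 2) :
    pauli₁ p x y = if x = y + p.2 then
      Complex.I ^ ((p.1 : ℕ) * (p.2 : ℕ)) * (-1) ^ ((p.1 : ℕ) * (y : ℕ)) else 0 := by
  obtain ⟨z, b⟩ := p
  fin_cases z <;> fin_cases b <;> fin_cases x <;> fin_cases y <;> simp [pauli₁]

lemma pauli_apply (a : PauliLabel n) (x y : Bits n) :
    pauli a x y = if x = (fun i => y i + (a i).2) then
      (∏ i, Complex.I ^ (((a i).1 : ℕ) * ((a i).2 : ℕ))) * sgn (fun i => (a i).1) y else 0 := by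
  simp only [pauli, tensor, Matrix.of_apply, pauli₁_apply, sgn]
  split_ifs with h
  · rw [← Finset.prod_mul_distrib]
    exact Finset.prod_congr rfl fun i _ => if_pos (congrFun h i)
  · obtain ⟨i, hi⟩ := Function.ne_iff.mp h
    exact Finset.prod_eq_zero (Finset.mem_univ i) (if_neg hi)

lemma pauliZ_eq_diagonal (z : Bits n) : pauliZ z = Matrix.diagonal (sgn z) := by
  have key : ∀ (a x y : Fin 2), (pauli₁ (1, 0) ^ (a : ℕ)) x y =
      if x = y then (-1) ^ ((a : ℕ) * (x : ℕ)) else 0 := by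
    intro a x y
    fin_cases a <;> fin_cases x <;> fin_cases y <;> simp [pauli₁]
  ext x y
  simp only [pauliZ, tensor, Matrix.of_apply, Matrix.diagonal_apply, key, sgn]
  split_ifs with h
  · subst h; simp
  · obtain ⟨i, hi⟩ := Function.ne_iff.mp h
    exact Finset.prod_eq_zero (Finset.mem_univ i) (if_neg hi)

lemma pauliZ_eq_pauli (z : Bits n) : pauliZ z = pauli fun i => (z i, 0) := by
  ext x y
  rw [pauliZ_eq_diagonal, pauli_apply, Matrix.diagonal_apply]
  by_cases h : x = y
  · subst h; simp
  · rw [if_neg h, if_neg]; simpa using h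

lemma pauli_zero : pauli (0 : PauliLabel n) = 1 := by
  rw [← tensor_one]; rfl

lemma trace_tensor (A : Fin n → Matrix (Fin 2) (Fin 2) ℂ) :
    (tensor A).trace = ∏ i, (A i).trace := by
  simp only [Matrix.trace, tensor, Matrix.diag_apply, Matrix.of_apply]
  rw [Finset.prod_univ_sum, Fintype.piFinset_univ]

lemma hsInner_pauli (a b : PauliLabel n) :
    hsInner (pauli a) (pauli b) = if a = b then (2 : ℂ) ^ n else 0 := by
  have key : ∀ p q : Fin 2 × Fin 2,
      ((pauli₁ p)ᴴ * pauli₁ q).trace = if p = q then (2 : ℂ) else 0 := by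
    rintro ⟨z, b⟩ ⟨z', b'⟩
    fin_cases z <;> fin_cases b <;> fin_cases z' <;> fin_cases b' <;>
      simp [pauli₁, Matrix.trace, Matrix.mul_apply] <;> norm_num
  simp only [hsInner, pauli, tensor_conjTranspose, tensor_mul, trace_tensor, key]
  split_ifs with h
  · subst h; simp
  · obtain ⟨i, hi⟩ := Function.ne_iff.mp h
    exact Finset.prod_eq_zero (Finset.mem_univ i) (if_neg hi)

lemma pauli_ne_zero (a : PauliLabel n) : pauli a ≠ 0 := by
  intro h
  have := hsInner_pauli a a
  simp only [h, hsInner, mul_zero, Matrix.trace_zero, if_pos] at this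
  exact pow_ne_zero n two_ne_zero this.symm

lemma ketbra_pauli_injective :
    Function.Injective fun a : PauliLabel n => ketbra (pauli a) (pauli a) := by
  intro a b h
  by_contra hab
  have h1 := LinearMap.congr_fun h (pauli a)
  simp only [ketbra_apply, hsInner_pauli, if_pos, if_neg (Ne.symm hab), zero_smul] at h1
  exact smul_ne_zero (pow_ne_zero n two_ne_zero) (pauli_ne_zero a) h1

lemma smul_pauli_eq {c : ℂ} {a b : PauliLabel n} (hc : c ^ 4 = 1)
    (h : pauli a = c • pauli b) : a = b :=
  ketbra_pauli_injective (by simp only [h, ketbra_phase hc])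

/-! ### The phased Pauli operators are stable under the Clifford group -/

/-- The operators `c σ_a` with `c ^ 4 = 1`. -/
def phasedPaulis (n : ℕ) : Set (Op n) := {A | ∃ c : ℂ, c ^ 4 = 1 ∧ ∃ a, A = c • pauli a}

lemma pauli_mem_phasedPaulis (a : PauliLabel n) : pauli a ∈ phasedPaulis n :=
  ⟨1, one_pow 4, a, (one_smul _ _).symm⟩

lemma finite_pow_eq_one (k : ℕ) (hk : 0 < k) : {c : ℂ | c ^ k = 1}.Finite := by
  refine (Polynomial.nthRoots k (1 : ℂ)).toFinset.finite_toSet.subset fun c hc => ?_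
  simpa [Polynomial.mem_nthRoots hk] using hc

lemma finite_phasedPaulis (n : ℕ) : (phasedPaulis n).Finite := by
  refine (((finite_pow_eq_one 4 (by norm_num)).prod
    (Set.finite_univ (α := PauliLabel n))).image fun p => p.1 • pauli p.2).subset ?_
  rintro _ ⟨c, hc, a, rfl⟩
  exact ⟨(c, a), ⟨hc, trivial⟩, rfl⟩

lemma ω_mem_phasedPaulis_of {g : UGroup n} (h : ∀ a, ω g (pauli a) ∈ phasedPaulis n) {A : Op n}
    (hA : A ∈ phasedPaulis n) : ω g A ∈ phasedPaulis n := by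
  obtain ⟨c, hc, a, rfl⟩ := hA
  obtain ⟨c', hc', b, hb⟩ := h a
  exact ⟨c * c', by rw [mul_pow, hc, hc', one_mul], b, by rw [map_smul, hb, smul_smul]⟩

lemma tensor_update_smul (A : Fin n → Matrix (Fin 2) (Fin 2) ℂ) (i : Fin n) (c : ℂ)
    (B : Matrix (Fin 2) (Fin 2) ℂ) :
    tensor (Function.update A i (c • B)) = c • tensor (Function.update A i B) := by
  ext x y
  simp only [tensor, Matrix.of_apply, Matrix.smul_apply, smul_eq_mul]
  rw [← Finset.mul_prod_erase _ _ (Finset.mem_univ i),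
    ← Finset.mul_prod_erase _ _ (Finset.mem_univ i), ← mul_assoc]
  congr 1
  · simp
  · refine Finset.prod_congr rfl fun j hj => ?_
    simp [Finset.ne_of_mem_erase hj]

lemma ω_onQubit_tensor (i : Fin n) (U : Matrix.unitaryGroup (Fin 2) ℂ)
    (A : Fin n → Matrix (Fin 2) (Fin 2) ℂ) :
    ω (onQubit i U) (tensor A) = tensor (Function.update A i
      ((U : Matrix (Fin 2) (Fin 2) ℂ) * A i * (U : Matrix (Fin 2) (Fin 2) ℂ)ᴴ)) := by
  rw [ω_apply, onQubit, tensor_conjTranspose, tensor_mul, tensor_mul]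
  congr 1
  funext j
  by_cases h : j = i
  · subst h; simp
  · simp [h]

lemma ω_onQubit_pauli (i : Fin n) (U : Matrix.unitaryGroup (Fin 2) ℂ) (a : PauliLabel n) {c : ℂ}
    {p : Fin 2 × Fin 2}
    (h : (U : Matrix (Fin 2) (Fin 2) ℂ) * pauli₁ (a i) * (U : Matrix (Fin 2) (Fin 2) ℂ)ᴴ =
      c • pauli₁ p) :
    ω (onQubit i U) (pauli a) = c • pauli (Function.update a i p) := by
  rw [pauli, ω_onQubit_tensor, h, tensor_update_smul, pauli]
  congr 2
  funext j
  by_cases hj : j = i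
  · subst hj; simp
  · simp [hj]

lemma hadamard_conj (p : Fin 2 × Fin 2) :
    hadamard * pauli₁ p * hadamardᴴ = ((-1 : ℂ) ^ ((p.1 : ℕ) * (p.2 : ℕ))) • pauli₁ p.swap := by
  have h : (((Real.sqrt 2 : ℝ) : ℂ)⁻¹) * (((Real.sqrt 2 : ℝ) : ℂ)⁻¹) = 1 / 2 := by
    rw [← mul_inv, ← Complex.ofReal_mul, Real.mul_self_sqrt (by norm_num)]
    norm_num
  have h' : (!![1, 1; 1, -1] : Matrix (Fin 2) (Fin 2) ℂ)ᴴ = !![1, 1; 1, -1] := by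
    ext i j
    fin_cases i <;> fin_cases j <;> simp
  obtain ⟨z, b⟩ := p
  rw [hadamard, Matrix.conjTranspose_smul, Matrix.smul_mul, Matrix.mul_smul, Matrix.smul_mul,
    smul_smul, Complex.star_def, map_inv₀, Complex.conj_ofReal, h, h']
  ext i j
  fin_cases z <;> fin_cases b <;> fin_cases i <;> fin_cases j <;>
    simp [pauli₁] <;> ring

lemma phase_conj (p : Fin 2 × Fin 2) :
    phase * pauli₁ p * phaseᴴ =
      ((-1 : ℂ) ^ ((p.1 : ℕ) * (p.2 : ℕ))) • pauli₁ (p.1 + p.2, p.2) := by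
  obtain ⟨z, b⟩ := p
  ext i j
  fin_cases z <;> fin_cases b <;> fin_cases i <;> fin_cases j <;>
    simp [pauli₁, phase, Matrix.mul_apply]

lemma neg_one_pow_pow_four (k : ℕ) : ((-1 : ℂ) ^ k) ^ 4 = 1 := by
  rw [← pow_mul, mul_comm, pow_mul]; norm_num

lemma I_pow_pow_four (k : ℕ) : (Complex.I ^ k) ^ 4 = 1 := by
  rw [← pow_mul, mul_comm, pow_mul, Complex.I_pow_four, one_pow]

lemma ωAdj_involutionGate (f : Bits n → Bits n) (hf : Function.Involutive f) (A : Op n)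
    (x y : Bits n) : ωAdj (involutionGate f hf) A x y = A (f x) (f y) := by
  simp [ωAdj_apply, involutionGate, Matrix.mul_apply]

lemma conjTranspose_involutionGate (f : Bits n → Bits n) (hf : Function.Involutive f) :
    ((involutionGate f hf : UGroup n) : Op n)ᴴ = involutionGate f hf := by
  ext u v
  have : v = f u ↔ u = f v := ⟨fun h => by rw [h, hf], fun h => by rw [h, hf]⟩
  simp [involutionGate, this]

lemma ω_involutionGate (f : Bits n → Bits n) (hf : Function.Involutive f) (A : Op n)
    (x y : Bits n) : ω (involutionGate f hf) A x y = A (f x) (f y) := by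
  have h := ωAdj_involutionGate f hf A x y
  rw [ωAdj_apply, conjTranspose_involutionGate] at h
  rwa [ω_apply, conjTranspose_involutionGate]

lemma sgn_update (z x : Bits n) (j : Fin n) (v : Fin 2) :
    sgn z (Function.update x j (x j + v)) = (-1) ^ ((z j : ℕ) * (v : ℕ)) * sgn z x := by
  have key : ∀ a b c : Fin 2, (-1 : ℂ) ^ ((a : ℕ) * ((b + c : Fin 2) : ℕ)) =
      (-1) ^ ((a : ℕ) * (c : ℕ)) * (-1) ^ ((a : ℕ) * (b : ℕ)) := by
    intro a b c
    fin_cases a <;> fin_cases b <;> fin_cases c <;> simp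
  rw [sgn, sgn, ← Finset.mul_prod_erase _ _ (Finset.mem_univ j),
    ← Finset.mul_prod_erase (a := j) _ (fun i => (-1 : ℂ) ^ ((z i : ℕ) * (x i : ℕ)))
      (Finset.mem_univ j), ← mul_assoc]
  congr 1
  · simp [key]
  · refine Finset.prod_congr rfl fun k hk => ?_
    simp [Finset.ne_of_mem_erase hk]

/-- Over `𝔽₂` the transpose of the CNOT matrix is CNOT with control and target exchanged. -/
lemma sgn_cnotFun (i j : Fin n) (z x : Bits n) : sgn z (cnotFun i j x) = sgn (cnotFun j i z) x := by
  rw [cnotFun, sgn_update, cnotFun, sgn_comm (Function.update z i (z i + z j)) x, sgn_update,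
    sgn_comm z x, mul_comm (z j : ℕ)]

lemma sgn_swapFun (i j : Fin n) (z x : Bits n) : sgn z (swapFun i j x) = sgn (swapFun i j z) x := by
  rw [sgn, sgn, ← Equiv.prod_comp (Equiv.swap i j)]
  simp [swapFun]

/-- CNOT is linear on bit strings, so it transports the flip part of a Pauli by its matrix and the
character part by the transposed matrix. -/
lemma ω_cnotGate_pauli_mem (i j : Fin n) (h : i ≠ j) (a : PauliLabel n) :
    ω (cnotGate i j h) (pauli a) ∈ phasedPaulis n := by
  set b : Bits n := cnotFun i j fun k => (a k).2 with hb
  set z : Bits n := cnotFun j i fun k => (a k).1 with hz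
  set q : PauliLabel n → ℂ := fun a => ∏ i, Complex.I ^ (((a i).1 : ℕ) * ((a i).2 : ℕ)) with hq
  have hq4 : ∀ a, q a ^ 4 = 1 := fun a => by
    simp only [hq, ← Finset.prod_pow, I_pow_pow_four, Finset.prod_const_one]
  set a' : PauliLabel n := fun k => (z k, b k) with ha'
  have hq0 : q a' ≠ 0 := fun h0 => by simpa [h0] using hq4 a'
  -- The phase compares the factors `i^{zb}` built into the old and the new label.
  refine ⟨q a / q a', by rw [div_pow, hq4, hq4, div_one], a', ?_⟩
  ext x y
  rw [cnotGate, ω_involutionGate, Matrix.smul_apply, pauli_apply, pauli_apply, sgn_cnotFun,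
    smul_eq_mul]
  have e : (cnotFun i j x = fun k => cnotFun i j y k + (a k).2) ↔
      x = fun k => y k + (a' k).2 := by
    have hadd : ∀ u v : Bits n, cnotFun i j (fun k => u k + v k) =
        fun k => cnotFun i j u k + cnotFun i j v k := by
      intro u v
      funext k
      by_cases hk : k = j
      · subst hk; simp only [cnotFun, Function.update_self]; abel
      · simp [cnotFun, hk]
    have hinv := cnotFun_involutive h
    rw [← hinv.injective.eq_iff, hinv, hadd, hinv]
  simp only [e]
  split_ifs
  · change q a * sgn z y = q a / q a' * (q a' * sgn z y)
    field_simp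
  · simp

lemma ω_mem_phasedPaulis {g : UGroup n} (hg : g ∈ Clifford n) :
    ∀ A ∈ phasedPaulis n, ω g A ∈ phasedPaulis n := by
  induction hg using Subgroup.closure_induction with
  | mem g hg =>
    intro A hA
    refine ω_mem_phasedPaulis_of (fun a => ?_) hA
    rcases hg with (⟨i, rfl⟩ | ⟨i, rfl⟩) | ⟨i, j, h, rfl⟩
    · exact ⟨_, neg_one_pow_pow_four _, _, ω_onQubit_pauli i _ a (hadamard_conj (a i))⟩
    · exact ⟨_, neg_one_pow_pow_four _, _, ω_onQubit_pauli i _ a (phase_conj (a i))⟩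
    · exact ω_cnotGate_pauli_mem i j h a
  | one => intro A hA; simpa [ω_apply] using hA
  | mul g h _ _ ihg ihh => intro A hA; rw [ω_mul_apply]; exact ihg _ (ihh A hA)
  | inv g _ ih =>
    intro A hA
    -- An injective self-map of the finite set of phased Paulis is onto, so the inverse preserves
    -- the set too.
    have hinj : Set.InjOn (ω g) (phasedPaulis n) :=
      (Function.LeftInverse.injective (ωAdj_ω g)).injOn
    obtain ⟨B, hB, rfl⟩ :=
      (((finite_phasedPaulis n).injOn_iff_bijOn_of_mapsTo ih).mp hinj).surjOn hA
    rwa [ω_inv, ωAdj_ω]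

lemma ωAdj_mem_phasedPaulis {g : UGroup n} (hg : g ∈ Clifford n) {A : Op n}
    (hA : A ∈ phasedPaulis n) : ωAdj g A ∈ phasedPaulis n := by
  rw [← ω_inv]
  exact ω_mem_phasedPaulis (inv_mem hg) A hA

/-! ### Finiteness of the Clifford group -/

lemma sum_sgn_mul_sgn (x y : Bits n) :
    ∑ z, sgn z x * sgn z y = if x = y then (2 : ℂ) ^ n else 0 := by
  have key : ∀ a b : Fin 2, ∑ c : Fin 2, (-1 : ℂ) ^ ((c : ℕ) * (a : ℕ)) *
      (-1) ^ ((c : ℕ) * (b : ℕ)) = if a = b then 2 else 0 := by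
    intro a b
    fin_cases a <;> fin_cases b <;> (simp; try norm_num)
  simp only [sgn, ← Finset.prod_mul_distrib]
  rw [← Fintype.piFinset_univ, ← Finset.prod_univ_sum (fun _ => Finset.univ)
    (fun i (c : Fin 2) => (-1 : ℂ) ^ ((c : ℕ) * (x i : ℕ)) * (-1) ^ ((c : ℕ) * (y i : ℕ)))]
  simp only [key]
  split_ifs with h
  · subst h; simp
  · obtain ⟨i, hi⟩ := Function.ne_iff.mp h
    exact Finset.prod_eq_zero (Finset.mem_univ i) (if_neg hi)

lemma sgn_mul_self (z x : Bits n) : sgn z x * sgn z x = 1 := by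
  rw [sgn, ← Finset.prod_mul_distrib]
  refine Finset.prod_eq_one fun i _ => ?_
  rw [← mul_pow]; norm_num

/-- Commuting with every `Z_z` kills the off-diagonal entries, since characters separate bit
strings. Commuting with the bit flips makes the diagonal constant. -/
lemma eq_smul_one_of_commute {g : Op n} (h : ∀ a, g * pauli a = pauli a * g) :
    ∃ c : ℂ, g = c • 1 := by
  have hdiag : ∀ x y, x ≠ y → g x y = 0 := by
    intro x y hxy
    have h1 : ∀ z, g x y * sgn z y = sgn z x * g x y := by
      intro z
      have := congrFun (congrFun (h fun i => (z i, 0)) x) y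
      rwa [← pauliZ_eq_pauli, pauliZ_eq_diagonal, Matrix.mul_diagonal, Matrix.diagonal_mul] at this
    -- Each summand on the left equals `g x y`, while character orthogonality makes the whole left
    -- side vanish.
    have h2 : ∑ z, sgn z x * sgn z y * g x y = ∑ _z : Bits n, g x y := by
      refine Finset.sum_congr rfl fun z _ => ?_
      rw [mul_assoc, mul_comm (sgn z y), h1, ← mul_assoc, sgn_mul_self, one_mul]
    rw [← Finset.sum_mul, sum_sgn_mul_sgn, if_neg hxy, zero_mul] at h2
    simpa using h2.symm
  refine ⟨g 0 0, ?_⟩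
  ext x y
  by_cases hxy : x = y
  · subst hxy
    have h1 := congrFun (congrFun (h fun i => (0, x i)) x) 0
    have h2 : ∀ u v : Bits n, pauli (fun i => ((0 : Fin 2), x i)) u v =
        if u = (fun i => v i + x i) then 1 else 0 := by
      intro u v
      simp [pauli_apply, sgn]
    have h3 : ∀ u : Bits n, (x = fun i => u i + x i) ↔ u = 0 := by
      intro u
      simp [funext_iff]
    rw [Matrix.mul_apply, Matrix.mul_apply] at h1
    simp only [h2, h3] at h1
    simpa using h1
  · simp [hxy, hdiag x y hxy]

lemma onQubit_mul (i : Fin n) (U V : Matrix.unitaryGroup (Fin 2) ℂ) :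
    onQubit i U * onQubit i V = onQubit i (U * V) := by
  apply Subtype.ext
  simp only [onQubit, Submonoid.coe_mul, MulMemClass.mk_mul_mk, tensor_mul]
  congr 1
  funext j
  by_cases h : j = i
  · subst h; simp
  · simp [h]

lemma onQubit_one (i : Fin n) : onQubit i 1 = (1 : UGroup n) := by
  apply Subtype.ext
  change tensor (Function.update (fun _ => 1) i 1) = 1
  rw [← tensor_one]
  congr 1
  simp

lemma onQubit_pow (i : Fin n) (U : Matrix.unitaryGroup (Fin 2) ℂ) (k : ℕ) :
    onQubit i U ^ k = onQubit i (U ^ k) := by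
  induction k with
  | zero => simp [onQubit_one]
  | succ k ih => rw [pow_succ, pow_succ, ih, onQubit_mul]

lemma hadamard_pow_four :
    (⟨hadamard, hadamard_mem⟩ : Matrix.unitaryGroup (Fin 2) ℂ) ^ 4 = 1 := by
  have h : (((Real.sqrt 2 : ℝ) : ℂ)⁻¹) * (((Real.sqrt 2 : ℝ) : ℂ)⁻¹) = 1 / 2 := by
    rw [← mul_inv, ← Complex.ofReal_mul, Real.mul_self_sqrt (by norm_num)]
    norm_num
  have h2 : hadamard ^ 2 = 1 := by
    rw [sq, hadamard, Matrix.smul_mul, Matrix.mul_smul, smul_smul, h]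
    ext i j
    fin_cases i <;> fin_cases j <;> simp <;> norm_num
  apply Subtype.ext
  change hadamard ^ (2 * 2) = 1
  rw [pow_mul, h2, one_pow]

lemma phase_pow_four : (⟨phase, phase_mem⟩ : Matrix.unitaryGroup (Fin 2) ℂ) ^ 4 = 1 := by
  have h2 : phase ^ 2 = !![1, 0; 0, -1] := by
    rw [sq, phase]
    ext i j
    fin_cases i <;> fin_cases j <;> simp
  apply Subtype.ext
  change phase ^ (2 * 2) = 1
  rw [pow_mul, h2, sq]
  ext i j
  fin_cases i <;> fin_cases j <;> simp

lemma involutionGate_pow_four (f : Bits n → Bits n) (hf : Function.Involutive f) :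
    involutionGate f hf ^ 4 = 1 := by
  have h2 : involutionGate f hf ^ 2 = 1 := by
    apply Subtype.ext
    have := UGroup.mul_conjTranspose (involutionGate f hf)
    rwa [conjTranspose_involutionGate, ← sq] at this
  rw [show (4 : ℕ) = 2 * 2 from rfl, pow_mul, h2, one_pow]

/-- Every generator has order dividing four. This is what limits the scalars contained in the group.
-/
lemma det_pow_four {g : UGroup n} (hg : g ∈ Clifford n) : (g : Op n).det ^ 4 = 1 := by
  induction hg using Subgroup.closure_induction with
  | mem g hg =>
    have h : g ^ 4 = 1 := by
      rcases hg with (⟨i, rfl⟩ | ⟨i, rfl⟩) | ⟨i, j, h, rfl⟩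
      · rw [onQubit_pow, hadamard_pow_four, onQubit_one]
      · rw [onQubit_pow, phase_pow_four, onQubit_one]
      · exact involutionGate_pow_four _ _
    rw [← Matrix.det_pow]
    have := congrArg (fun u : UGroup n => (u : Op n).det) h
    simpa using this
  | one => simp
  | mul g h _ _ ihg ihh => simp [Matrix.det_mul, mul_pow, ihg, ihh]
  | inv g _ ih =>
    have h : (g : Op n).det * ((g⁻¹ : UGroup n) : Op n).det = 1 := by
      rw [← Matrix.det_mul, ← Submonoid.coe_mul]
      simp
    have h4 := congrArg (· ^ 4) h
    simp only [mul_pow, ih, one_mul, one_pow] at h4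
    exact h4

/-- Here `h⁻¹g` commutes with all Paulis, hence is a scalar `c`, and its determinant is `c` to the
power `2ⁿ`. -/
lemma eq_smul_of_ω_eq {g h : Clifford n}
    (hgh : ∀ a, ω (g : UGroup n) (pauli a) = ω (h : UGroup n) (pauli a)) :
    ∃ c : ℂ, c ^ (2 ^ n * 4) = 1 ∧ ((g : UGroup n) : Op n) = c • ((h : UGroup n) : Op n) := by
  set k : Clifford n := h⁻¹ * g with hk
  have hfix : ∀ a, ω (k : UGroup n) (pauli a) = pauli a := by
    intro a
    rw [hk, Subgroup.coe_mul, ω_mul_apply, hgh, Subgroup.coe_inv, ω_inv, ωAdj_ω]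
  obtain ⟨c, hc⟩ := eq_smul_one_of_commute (g := ((k : UGroup n) : Op n)) fun a => by
    conv_rhs => rw [← hfix a]
    rw [ω_apply, mul_assoc, UGroup.conjTranspose_mul, mul_one]
  refine ⟨c, ?_, ?_⟩
  · have := det_pow_four k.2
    rw [hc, Matrix.det_smul, Matrix.det_one, mul_one, ← pow_mul] at this
    simpa using this
  · have : g = h * k := by simp [hk]
    rw [this, Subgroup.coe_mul, Submonoid.coe_mul, hc]
    simp

/-- The action on Paulis takes finitely many values, and each fibre lies in the multiples of one
element by roots of unity of fixed order. -/
lemma finite_clifford (n : ℕ) : Finite (Clifford n) := by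
  have : Finite (phasedPaulis n) := finite_phasedPaulis n
  let f : Clifford n → PauliLabel n → phasedPaulis n := fun g a =>
    ⟨ω (g : UGroup n) (pauli a), ω_mem_phasedPaulis g.2 _ (pauli_mem_phasedPaulis a)⟩
  rw [← Set.finite_univ_iff]
  refine (Set.Finite.preimage' (f := f) (Set.toFinite (Set.range f)) ?_).subset fun g _ => ⟨g, rfl⟩
  rintro _ ⟨h, rfl⟩
  have hinj : Function.Injective fun g : Clifford n => ((g : UGroup n) : Op n) :=
    Subtype.val_injective.comp Subtype.val_injective
  refine Set.Finite.of_finite_image (((finite_pow_eq_one (2 ^ n * 4) (by positivity)).image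
    fun c => c • ((h : UGroup n) : Op n)).subset ?_) hinj.injOn
  rintro _ ⟨g, hg, rfl⟩
  obtain ⟨c, hc, e⟩ := eq_smul_of_ω_eq (g := g) (h := h) fun a =>
    congrArg Subtype.val (congrFun hg a)
  exact ⟨c, hc, e.symm⟩

/-! ### Reduction of Pauli operators to diagonal ones -/

/-- On one qubit the Hadamard gate sends `X` to `Z`, and the phase gate first turns `Y` into `-X`;
`1` and `Z` are already diagonal. -/
lemma exists_ω_pauli_update (a : PauliLabel n) (i : Fin n) :
    ∃ g ∈ Clifford n, ∃ c : ℂ, c ^ 4 = 1 ∧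
      ω g (pauli a) = c • pauli (Function.update a i (if a i = 0 then 0 else 1, 0)) := by
  have hH : onQubit i ⟨hadamard, hadamard_mem⟩ ∈ Clifford n :=
    Subgroup.subset_closure (Or.inl (Or.inl ⟨i, rfl⟩))
  have hS : onQubit i ⟨phase, phase_mem⟩ ∈ Clifford n :=
    Subgroup.subset_closure (Or.inl (Or.inr ⟨i, rfl⟩))
  have h1 : ∀ p, a i = p → p.2 = 0 → ∃ g ∈ Clifford n, ∃ c : ℂ, c ^ 4 = 1 ∧
      ω g (pauli a) = c • pauli (Function.update a i p) := by
    rintro p rfl -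
    exact ⟨1, one_mem _, 1, one_pow 4, by simp [ω_apply]⟩
  obtain ⟨p, hp⟩ : ∃ p, a i = p := ⟨_, rfl⟩
  rw [hp]
  have hcases : ∀ p : Fin 2 × Fin 2, p = (0, 0) ∨ p = (1, 0) ∨ p = (0, 1) ∨ p = (1, 1) := by
    decide
  rcases hcases p with rfl | rfl | rfl | rfl
  · exact h1 _ hp rfl
  · exact h1 _ hp rfl
  · refine ⟨_, hH, 1, one_pow 4, ω_onQubit_pauli i _ a ((hadamard_conj (a i)).trans ?_)⟩
    rw [hp]; simp
  · have e1 : ω (onQubit i ⟨phase, phase_mem⟩) (pauli a) =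
        (-1 : ℂ) • pauli (Function.update a i (0, 1)) :=
      ω_onQubit_pauli i _ a ((phase_conj (a i)).trans (by rw [hp]; simp))
    have e2 : ω (onQubit i ⟨hadamard, hadamard_mem⟩) (pauli (Function.update a i (0, 1))) =
        (1 : ℂ) • pauli (Function.update (Function.update a i (0, 1)) i (1, 0)) :=
      ω_onQubit_pauli i _ _ ((hadamard_conj _).trans (by simp))
    refine ⟨_, mul_mem hH hS, -1, by norm_num, ?_⟩
    rw [ω_mul_apply, e1, map_smul, e2, Function.update_idem, one_smul]
    rfl

lemma exists_ω_pauli_eq_pauliZ (a : PauliLabel n) :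
    ∃ g ∈ Clifford n, ∃ c : ℂ, c ^ 4 = 1 ∧
      ω g (pauli a) = c • pauliZ fun i => if a i = 0 then 0 else 1 := by
  have key : ∀ s : Finset (Fin n), ∃ g ∈ Clifford n, ∃ c : ℂ, c ^ 4 = 1 ∧
      ω g (pauli a) = c • pauli fun i => if i ∈ s then (if a i = 0 then 0 else 1, 0) else a i := by
    intro s
    induction s using Finset.induction_on with
    | empty => exact ⟨1, one_mem _, 1, one_pow 4, by simp [ω_apply]⟩
    | insert j s hj ih =>
      obtain ⟨g, hg, c, hc, e⟩ := ih
      obtain ⟨g', hg', c', hc', e'⟩ := exists_ω_pauli_update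
        (fun i => if i ∈ s then ((if a i = 0 then 0 else 1 : Fin 2), (0 : Fin 2)) else a i) j
      refine ⟨g' * g, mul_mem hg' hg, c * c', by rw [mul_pow, hc, hc', one_mul], ?_⟩
      rw [ω_mul_apply, e, map_smul, e', smul_smul]
      congr 2
      funext i
      by_cases h : i = j
      · subst h; simp [hj]
      · simp [h]
  obtain ⟨g, hg, c, hc, e⟩ := key Finset.univ
  exact ⟨g, hg, c, hc, by simpa [pauliZ_eq_pauli] using e⟩

/-! ### The set `𝒩` and the nonzero bit strings -/

/-- The label of the diagonal Pauli operator `h† Z₁ h` for a chain `h` of length `i`. -/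
def chainLabel (n i : ℕ) (c : ℕ → Bool) : Bits n := fun k =>
  if (k : ℕ) < i then (if c k then 1 else 0) else if (k : ℕ) = i then 1 else 0

lemma ωAdj_involutionGate_pauliZ (f : Bits n → Bits n) (hf : Function.Involutive f)
    {z w : Bits n} (h : ∀ x, sgn z (f x) = sgn w x) :
    ωAdj (involutionGate f hf) (pauliZ z) = pauliZ w := by
  ext x y
  rw [ωAdj_involutionGate, pauliZ_eq_diagonal, pauliZ_eq_diagonal, Matrix.diagonal_apply,
    Matrix.diagonal_apply, h]
  simp only [hf.injective.eq_iff]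

lemma ωAdj_pairGate_pauliZ (b : Bool) (i j : Fin n) (h : i ≠ j) (z : Bits n) :
    ωAdj (pairGate b i j h : UGroup n) (pauliZ z) =
      pauliZ (if b then cnotFun j i z else swapFun i j z) := by
  cases b
  · exact ωAdj_involutionGate_pauliZ _ (swapFun_involutive i j) (sgn_swapFun i j z)
  · exact ωAdj_involutionGate_pauliZ _ (cnotFun_involutive h) (sgn_cnotFun i j z)

/-- The rightmost factor of the chain acts last under the adjoint, so lengthening the chain by one
moves the topmost `1` up one place. SWAP leaves a `0` behind, CNOT copies the bit and leaves a `1`.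
-/
lemma ωAdj_chain [NeZero n] (i : ℕ) (hi : i < n) (c : ℕ → Bool) :
    ωAdj (chain i hi (fun j => c j) : UGroup n) (Z₁ n) = pauliZ (chainLabel n i c) := by
  induction i with
  | zero =>
    have : (Pi.single 0 1 : Bits n) = chainLabel n 0 c := by
      funext k
      by_cases hk : k = 0
      · simp [chainLabel, hk]
      · simp [chainLabel, hk]
    simp [chain, ωAdj_apply, Z₁, this]
  | succ i ih =>
    have hi₀ : i < n := by omega
    have e : chain (i + 1) hi (fun j => c j) = chain i hi₀ (fun j => c j) *
        pairGate (c i) ⟨i + 1, hi⟩ ⟨i, hi₀⟩ (by simp [Fin.ext_iff]) := by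
      simp only [chain, List.ofFn_succ_last, List.prod_append, List.prod_singleton]
      rfl
    rw [e, Subgroup.coe_mul, ωAdj_mul_apply, ih, ωAdj_pairGate_pauliZ]
    congr 1
    funext k
    rcases Bool.eq_false_or_eq_true (c i) with hc | hc
    · rw [hc, if_pos rfl, cnotFun]
      by_cases hk : (k : ℕ) = i + 1
      · have : k = ⟨i + 1, hi⟩ := Fin.ext hk
        subst this
        simp [chainLabel]
      · rw [Function.update_of_ne (by simpa [Fin.ext_iff] using hk)]
        by_cases hk' : (k : ℕ) = i
        · simp [chainLabel, hk', hc]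
        · have : (k : ℕ) < i + 1 ↔ (k : ℕ) < i := by omega
          simp [chainLabel, hk, hk', this]
    · rw [hc, if_neg (by simp), swapFun]
      by_cases hk : (k : ℕ) = i + 1
      · have : k = ⟨i + 1, hi⟩ := Fin.ext hk
        subst this
        simp [chainLabel]
      · by_cases hk' : (k : ℕ) = i
        · have : k = ⟨i, hi₀⟩ := Fin.ext hk'
          subst this
          simp [chainLabel, hc]
        · rw [Equiv.swap_apply_of_ne_of_ne (by simpa [Fin.ext_iff] using hk)
            (by simpa [Fin.ext_iff] using hk')]
          have : (k : ℕ) < i + 1 ↔ (k : ℕ) < i := by omega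
          simp [chainLabel, hk, hk', this]

/-- The identity is the chain of length `0`. Gate choices are extended to all of `ℕ`, with
irrelevant values beyond the length, so that chains of different lengths can be compared. -/
lemma mem_𝒩_iff [NeZero n] (h : Clifford n) :
    h ∈ 𝒩 n ↔ ∃ (i : ℕ) (hi : i < n) (c : ℕ → Bool), h = chain i hi fun j => c j := by
  constructor
  · rintro (rfl | ⟨i, -, hi, c, rfl⟩)
    · exact ⟨0, Nat.pos_of_neZero n, fun _ => false, by simp [chain]⟩
    · refine ⟨i, hi, fun k => if hk : k < i then c ⟨k, hk⟩ else false, ?_⟩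
      simp
  · rintro ⟨i, hi, c, rfl⟩
    rcases Nat.eq_zero_or_pos i with rfl | h
    · exact Or.inl (by simp [chain])
    · exact Or.inr ⟨i, h, hi, _, rfl⟩

lemma chainLabel_ne_zero {i : ℕ} (hi : i < n) (c : ℕ → Bool) : chainLabel n i c ≠ 0 := by
  intro h
  simpa [chainLabel] using congrFun h ⟨i, hi⟩

lemma le_of_chainLabel_eq {i i' : ℕ} (hi' : i' < n) {c c' : ℕ → Bool}
    (h : chainLabel n i c = chainLabel n i' c') : i' ≤ i := by
  by_contra! hlt
  have := congrFun h ⟨i', hi'⟩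
  simp [chainLabel, not_lt.mpr hlt.le, hlt.ne'] at this

/-- The position of the last `1` in the label is the length of the chain, and the bits below it are
the gate choices. -/
lemma chain_eq_of_chainLabel_eq {i i' : ℕ} (hi : i < n) (hi' : i' < n) {c c' : ℕ → Bool}
    (h : chainLabel n i c = chainLabel n i' c') :
    chain i hi (fun j => c j) = chain i' hi' fun j => c' j := by
  obtain rfl : i = i' := le_antisymm (le_of_chainLabel_eq hi h.symm) (le_of_chainLabel_eq hi' h)
  congr 1
  funext j
  have := congrFun h ⟨j, j.2.trans hi⟩
  simp only [chainLabel, j.2, if_true] at this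
  cases hc : c j <;> cases hc' : c' j <;> simp_all

lemma exists_chainLabel_eq {z : Bits n} (hz : z ≠ 0) :
    ∃ (i : ℕ) (_ : i < n) (c : ℕ → Bool), chainLabel n i c = z := by
  have hne : (Finset.univ.filter fun k => z k ≠ 0).Nonempty := by
    obtain ⟨k, hk⟩ := Function.ne_iff.mp hz
    exact ⟨k, by simpa using hk⟩
  -- The chain length has to be the position of the last nonzero bit.
  set m := (Finset.univ.filter fun k => z k ≠ 0).max' hne with hm
  have hbit : ∀ b : Fin 2, b ≠ 0 → b = 1 := by decide
  have hzm : z m = 1 := hbit _ (Finset.mem_filter.mp (Finset.max'_mem _ hne)).2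
  have hgt : ∀ k, m < k → z k = 0 := by
    intro k hk
    by_contra h
    exact absurd (Finset.le_max' _ k (by simpa using h)) (not_le.mpr hk)
  refine ⟨m, m.2, fun k => if hk : k < n then decide (z ⟨k, hk⟩ = 1) else false, ?_⟩
  funext k
  rcases lt_trichotomy k m with h | h | h
  · have h' : (k : ℕ) < m := h
    by_cases h1 : z k = 1
    · simp [chainLabel, h', h1]
    · have h0 : z k = 0 := by
        by_contra h0
        exact h1 (hbit _ h0)
      simp [chainLabel, h', h0]
  · subst h
    simp [chainLabel, hzm]
  · have h' : (m : ℕ) < k := h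
    simp [chainLabel, not_lt.mpr h'.le, h'.ne', hgt k h]

lemma pauliZ_injective : Function.Injective (pauliZ : Bits n → Op n) := by
  intro z w h
  rw [pauliZ_eq_pauli, pauliZ_eq_pauli] at h
  have := smul_pauli_eq (one_pow 4) (h.trans (one_smul _ _).symm)
  funext i
  exact congrArg Prod.fst (congrFun this i)

lemma exists_equiv_𝒩 (n : ℕ) [NeZero n] :
    ∃ e : {z : Bits n // z ≠ 0} ≃ 𝒩 n,
      ∀ z, ωAdj ((e z : Clifford n) : UGroup n) (Z₁ n) = pauliZ z := by
  have hex : ∀ z : {z : Bits n // z ≠ 0}, ∃ h : 𝒩 n,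
      ωAdj ((h : Clifford n) : UGroup n) (Z₁ n) = pauliZ z := by
    rintro ⟨z, hz⟩
    obtain ⟨i, hi, c, rfl⟩ := exists_chainLabel_eq hz
    exact ⟨⟨_, (mem_𝒩_iff _).mpr ⟨i, hi, c, rfl⟩⟩, ωAdj_chain i hi c⟩
  choose f hf using hex
  refine ⟨Equiv.ofBijective f ⟨fun z w h => ?_, ?_⟩, hf⟩
  · apply Subtype.ext
    apply pauliZ_injective
    rw [← hf, ← hf, h]
  -- The value of `f` comes from a choice, so it is re-expanded as a chain; having the same label as
  -- `h`, it is the same chain.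
  · rintro ⟨h, hh⟩
    obtain ⟨i, hi, c, rfl⟩ := (mem_𝒩_iff _).mp hh
    refine ⟨⟨_, chainLabel_ne_zero hi c⟩, Subtype.ext ?_⟩
    obtain ⟨i', hi', c', e⟩ := (mem_𝒩_iff _).mp (f ⟨_, chainLabel_ne_zero hi c⟩).2
    rw [e]
    refine chain_eq_of_chainLabel_eq hi' hi (pauliZ_injective ?_)
    rw [← ωAdj_chain i' hi' c', ← e, hf]

/-! ### Action on the projector onto `Z₁` -/

/-- The superoperator `ω(g)† |Z₁)(Z₁| ω(g)`. -/
noncomputable def ketbraConj [NeZero n] (g : Clifford n) : SuperOp n :=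
  ωAdj (g : UGroup n) * ketbra (Z₁ n) (Z₁ n) * ω (g : UGroup n)

lemma ketbraConj_eq [NeZero n] (g : Clifford n) :
    ketbraConj g = ketbra (ωAdj (g : UGroup n) (Z₁ n)) (ωAdj (g : UGroup n) (Z₁ n)) :=
  ωAdj_mul_ketbra_mul_ω _ _ _

lemma ketbraConj_one [NeZero n] : ketbraConj (1 : Clifford n) = ketbra (Z₁ n) (Z₁ n) := by
  simp [ketbraConj_eq, ωAdj_apply]

lemma ketbraConj_mul [NeZero n] (g h : Clifford n) :
    ketbraConj (g * h) = ωAdj (h : UGroup n) * ketbraConj g * ω (h : UGroup n) := by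
  rw [ketbraConj_eq, ketbraConj_eq, ωAdj_mul_ketbra_mul_ω, Subgroup.coe_mul, ωAdj_mul_apply]

lemma mem_St_iff [NeZero n] (g : Clifford n) : g ∈ St n ↔ ketbraConj g = ketbraConj 1 := by
  rw [ketbraConj_one]; rfl

/-- Transitivity: rotate `σ_a` to some `Z_z` with `z ≠ 0` by local gates, then reach `Z_z` from `Z₁`
by an element of `𝒩`. -/
lemma exists_ketbraConj_eq [NeZero n] {a : PauliLabel n} (ha : a ≠ 0) :
    ∃ g : Clifford n, ketbraConj g = ketbra (pauli a) (pauli a) := by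
  obtain ⟨g, hg, c, hc, e⟩ := exists_ω_pauli_eq_pauliZ a
  obtain ⟨f, hf⟩ := exists_equiv_𝒩 n
  have hz : (fun i => if a i = 0 then 0 else 1 : Bits n) ≠ 0 := by
    obtain ⟨i, hi⟩ := Function.ne_iff.mp ha
    intro h
    have := congrFun h i
    simp only [Pi.zero_apply] at this hi
    simp [hi] at this
  have hZ := hf ⟨_, hz⟩
  have h1 := ωAdj_ω g (pauli a)
  rw [e, map_smul] at h1
  refine ⟨f ⟨_, hz⟩ * ⟨g, hg⟩, ?_⟩
  rw [ketbraConj_eq, Subgroup.coe_mul, ωAdj_mul_apply, hZ, ← h1, ketbra_phase hc]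

lemma exists_eq_ketbraConj [NeZero n] (g : Clifford n) :
    ∃ a : PauliLabel n, a ≠ 0 ∧ ketbraConj g = ketbra (pauli a) (pauli a) := by
  have hmem : Z₁ n ∈ phasedPaulis n := by
    rw [Z₁, pauliZ_eq_pauli]
    exact pauli_mem_phasedPaulis _
  obtain ⟨c, hc, a, e⟩ := ωAdj_mem_phasedPaulis g.2 hmem
  refine ⟨a, ?_, by rw [ketbraConj_eq, e, ketbra_phase hc]⟩
  -- Conjugation fixes scalars, so a scalar `h† Z₁ h` would force `Z₁` itself to be a multiple of
  -- the identity.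
  rintro rfl
  have h1 := ω_ωAdj (g : UGroup n) (Z₁ n)
  rw [e, map_smul, pauli_zero, ω_apply, mul_one, UGroup.mul_conjTranspose, ← pauli_zero, Z₁,
    pauliZ_eq_pauli] at h1
  have h2 := congrArg Prod.fst (congrFun (smul_pauli_eq hc h1.symm) 0)
  simp at h2

/-- Right cosets of the stabilizer correspond to points of the orbit of `|Z₁)(Z₁|`, and this orbit
consists of the `|σ_a)(σ_a|` with `a ≠ 0`. -/
lemma bijective_mul_representative [NeZero n] {γ : PauliLabel n → Clifford n}
    (hγ : ∀ a, a ≠ 0 → ketbraConj (γ a) = ketbra (pauli a) (pauli a)) :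
    Function.Bijective fun p : {a : PauliLabel n // a ≠ 0} × St n =>
      (p.2 : Clifford n) * γ p.1 := by
  have key : ∀ (a : PauliLabel n) (h : St n), ketbraConj ((h : Clifford n) * γ a) =
      ketbraConj (γ a) := by
    intro a h
    rw [ketbraConj_mul, (mem_St_iff _).mp h.2, ← ketbraConj_mul, one_mul]
  constructor
  · rintro ⟨⟨a, ha⟩, h⟩ ⟨⟨b, hb⟩, k⟩ e
    have hab : a = b := by
      apply ketbra_pauli_injective
      have := congrArg ketbraConj e
      simpa only [key, hγ _ ha, hγ _ hb] using this
    subst hab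
    have hhk : h = k := Subtype.ext (mul_right_cancel e)
    rw [hhk]
  · intro g
    obtain ⟨a, ha, e⟩ := exists_eq_ketbraConj g
    refine ⟨⟨⟨a, ha⟩, ⟨g * (γ a)⁻¹, (mem_St_iff _).mpr ?_⟩⟩, by simp⟩
    rw [ketbraConj_mul, e, ← hγ a ha, ← ketbraConj_mul, mul_inv_cancel]

/-! ### The noisy frame operator -/

/-- Both sides send `C` to its diagonal part; on the right this is orthogonality of the characters
`sgn`. -/
lemma measurement_eq (n : ℕ) :
    measurement n = ((2 : ℂ) ^ n)⁻¹ • ∑ z : Bits n, ketbra (pauliZ z) (pauliZ z) := by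
  have hd : ((2 : ℂ) ^ n) ≠ 0 := pow_ne_zero n two_ne_zero
  have hreal : ∀ z x : Bits n, star (sgn z x) = sgn z x := fun z x => by simp [sgn]
  ext1 C
  have h1 : ∀ z : Bits n, hsInner (pauliZ z) C = ∑ w, sgn z w * C w w := by
    intro z
    rw [hsInner, pauliZ_eq_diagonal, Matrix.diagonal_conjTranspose]
    simp [Matrix.trace, Matrix.diagonal_mul, Pi.star_apply, hreal]
  have h2 : ∀ x : Bits n, hsInner (Matrix.single x x 1) C = C x x := by
    intro x
    simp [hsInner, Matrix.trace_single_mul]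
  have hL : measurement n C = Matrix.diagonal fun x => C x x := by
    simp only [measurement, LinearMap.sum_apply, ketbra_apply, h2, Matrix.smul_single, smul_eq_mul,
      mul_one]
    ext x y
    rw [Matrix.sum_apply, Matrix.diagonal_apply]
    simp only [Matrix.single_apply]
    by_cases h : x = y
    · subst h; simp
    · rw [if_neg h]
      exact Finset.sum_eq_zero fun w _ => if_neg fun hw => h (hw.1.symm.trans hw.2)
  rw [hL, LinearMap.smul_apply, LinearMap.sum_apply, eq_inv_smul_iff₀ hd]
  simp only [ketbra_apply, h1]
  simp only [pauliZ_eq_diagonal]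
  ext x y
  simp only [Matrix.smul_apply, Matrix.sum_apply, Matrix.diagonal_apply, smul_eq_mul]
  by_cases h : x = y
  · subst h
    simp only [if_true, Finset.sum_mul]
    rw [Finset.sum_comm]
    have : ∀ w, ∑ z : Bits n, sgn z w * C w w * sgn z x =
        (if w = x then (2 : ℂ) ^ n else 0) * C w w := by
      intro w
      rw [← sum_sgn_mul_sgn, Finset.sum_mul]
      exact Finset.sum_congr rfl fun z _ => by ring
    simp [this]
  · simp [h]

lemma ketbra_normalized (A : Op n) :
    ketbra (normalized A) (normalized A) = ((2 : ℂ) ^ n)⁻¹ • ketbra A A := by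
  rw [normalized, ketbra_smul]
  congr 1
  rw [Complex.star_def, map_inv₀, Complex.conj_ofReal, ← mul_inv, ← Complex.ofReal_mul,
    Real.mul_self_sqrt (by positivity)]
  norm_num

/-- `|1)(1|` is `A ↦ Tr(A) 1`, which sees only the trace. -/
lemma ketbra_one_mul_channel {Φ : SuperOp n} (hΦ : IsChannel Φ) :
    ketbra (1 : Op n) 1 * Φ = ketbra 1 1 := by
  ext1 C
  simp [ketbra_apply, hsInner, hΦ.tracePreserving]

lemma avg_eq_sum {α V : Type*} [Fintype α] [AddCommGroup V] [Module ℂ V] (f : α → V) :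
    avg f = (Fintype.card α : ℂ)⁻¹ • ∑ x, f x := by
  rw [avg, finsum_eq_sum_of_fintype, Nat.card_eq_fintype_card]

lemma pauliZ_zero : pauliZ (0 : Bits n) = 1 := by
  rw [pauliZ_eq_pauli, ← pauli_zero]; rfl

lemma sum_ketbra_pauliZ [NeZero n] [Fintype (Clifford n)] [Fintype (St n)]
    {γ : PauliLabel n → Clifford n}
    (hγ : ∀ a, a ≠ 0 → ketbraConj (γ a) = ketbra (pauli a) (pauli a))
    (Λ : Clifford n → SuperOp n) {h : Clifford n} {z : Bits n}
    (hz : ωAdj (h : UGroup n) (Z₁ n) = pauliZ z) :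
    ∑ g : Clifford n, ωAdj (g : UGroup n) * ketbra (pauliZ z) (pauliZ z) * ω (g : UGroup n) * Λ g =
      ∑ a : {a : PauliLabel n // a ≠ 0}, ketbra (pauli (a : PauliLabel n)) (pauli a) *
        ∑ h' : St n, Λ (h⁻¹ * h' * γ a) := by
  have h1 : ∀ g : Clifford n,
      ωAdj (g : UGroup n) * ketbra (pauliZ z) (pauliZ z) * ω (g : UGroup n) =
        ketbraConj (h * g) := by
    intro g
    rw [ketbraConj_mul, ketbraConj_eq, hz]
  have key := bijective_mul_representative hγ
  simp only [h1]
  -- Left translation by `h⁻¹` turns `Z_z` into `Z₁` and puts `h⁻¹` into the argument of `Λ`; then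
  -- the sum is split over cosets.
  rw [← Equiv.sum_comp (Equiv.mulLeft h⁻¹), ← key.sum_comp, Fintype.sum_prod_type]
  refine Finset.sum_congr rfl fun a _ => ?_
  rw [Finset.mul_sum]
  refine Finset.sum_congr rfl fun h' _ => ?_
  simp only [Equiv.coe_mulLeft, mul_inv_cancel_left]
  rw [← mul_assoc, ketbraConj_mul, (mem_St_iff _).mp h'.2,
    ← ketbraConj_mul, one_mul, hγ a a.2]

/-- There is one coset for each of the `4ⁿ - 1` nonzero labels; the count is factored so that `2ⁿ -
1` can be matched with `|𝒩|`. -/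
lemma card_clifford [NeZero n] [Fintype (Clifford n)] [Fintype (St n)] :
    (Fintype.card (Clifford n) : ℂ) =
      ((2 : ℂ) ^ n - 1) * ((2 : ℂ) ^ n + 1) * Fintype.card (St n) := by
  choose! γ hγ using fun a (ha : a ≠ 0) => exists_ketbraConj_eq (n := n) ha
  have h := Fintype.card_of_bijective (bijective_mul_representative hγ)
  have hs : Fintype.card {a : PauliLabel n // a ≠ 0} = 4 ^ n - 1 := by
    rw [Fintype.card_subtype_compl]
    simp
  have h4 : (4 : ℂ) ^ n = 2 ^ n * 2 ^ n := by rw [← mul_pow]; norm_num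
  rw [← h, Fintype.card_prod, hs, Nat.cast_mul, Nat.cast_sub (Nat.one_le_pow _ _ (by norm_num))]
  push_cast
  rw [h4]
  ring

lemma card_𝒩 [NeZero n] [Fintype (𝒩 n)] : (Fintype.card (𝒩 n) : ℂ) = (2 : ℂ) ^ n - 1 := by
  obtain ⟨e, -⟩ := exists_equiv_𝒩 n
  rw [← Fintype.card_congr e, Fintype.card_subtype_compl]
  simp

theorem noisyFrameOperator_eq [NeZero n] {Λ : Clifford n → SuperOp n} (hΛ : ∀ g, IsChannel (Λ g))
    {γ : PauliLabel n → Clifford n}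
    (hγ : ∀ a, a ≠ 0 → ketbraConj (γ a) = ketbra (pauli a) (pauli a)) :
    noisyFrameOperator Λ =
      ketbra (normalized (1 : Op n)) (normalized (1 : Op n)) +
        ((2 : ℂ) ^ n + 1)⁻¹ •
          ∑ a ∈ Finset.univ.filter (fun a : PauliLabel n => a ≠ 0),
            ketbra (normalized (pauli a)) (normalized (pauli a)) *
              avg (fun h : 𝒩 n => avg (fun h' : St n =>
                Λ ((h : Clifford n)⁻¹ * (h' : Clifford n) * γ a))) := by
  have := finite_clifford n
  have := Fintype.ofFinite (Clifford n)
  have := Fintype.ofFinite (St n)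
  have := Fintype.ofFinite (𝒩 n)
  obtain ⟨e, he⟩ := exists_equiv_𝒩 n
  have hG : (Fintype.card (Clifford n) : ℂ) ≠ 0 := Nat.cast_ne_zero.mpr Fintype.card_ne_zero
  have hN : ((2 : ℂ) ^ n - 1) ≠ 0 ∧ ((2 : ℂ) ^ n + 1) ≠ 0 ∧ (Fintype.card (St n) : ℂ) ≠ 0 := by
    rw [card_clifford] at hG
    exact ⟨left_ne_zero_of_mul (left_ne_zero_of_mul hG),
      right_ne_zero_of_mul (left_ne_zero_of_mul hG), right_ne_zero_of_mul hG⟩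
  have h0 : ∑ g : Clifford n,
      ωAdj (g : UGroup n) * ketbra (pauliZ 0) (pauliZ 0) * ω (g : UGroup n) * Λ g =
        (Fintype.card (Clifford n) : ℂ) • ketbra (1 : Op n) 1 := by
    have : ∀ g : Clifford n,
        ωAdj (g : UGroup n) * ketbra (pauliZ 0) (pauliZ 0) * ω (g : UGroup n) * Λ g =
          ketbra (1 : Op n) 1 := by
      intro g
      have h1 : ωAdj (g : UGroup n) 1 = 1 := by
        rw [ωAdj_apply, mul_one, UGroup.conjTranspose_mul]
      rw [ωAdj_mul_ketbra_mul_ω, pauliZ_zero, h1, ketbra_one_mul_channel (hΛ g)]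
    simp only [this, Finset.sum_const, Finset.card_univ, Nat.cast_smul_eq_nsmul]
  have h1 : ∑ z : {z : Bits n // z ≠ 0}, ∑ g : Clifford n,
      ωAdj (g : UGroup n) * ketbra (pauliZ z.1) (pauliZ z.1) * ω (g : UGroup n) * Λ g =
        ∑ a : {a : PauliLabel n // a ≠ 0}, ketbra (pauli (a : PauliLabel n)) (pauli a) *
          ∑ h : 𝒩 n, ∑ h' : St n, Λ ((h : Clifford n)⁻¹ * h' * γ a) := by
    simp only [fun z => sum_ketbra_pauliZ hγ Λ (he z)]
    rw [Finset.sum_comm]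
    refine Finset.sum_congr rfl fun a _ => ?_
    rw [← Finset.mul_sum]
    congr 1
    exact Equiv.sum_comp e fun h : 𝒩 n => ∑ h' : St n, Λ ((h : Clifford n)⁻¹ * h' * γ a)
  have hL : noisyFrameOperator Λ = (Fintype.card (Clifford n) : ℂ)⁻¹ • ((2 : ℂ) ^ n)⁻¹ •
      ∑ z : Bits n, ∑ g : Clifford n,
        ωAdj (g : UGroup n) * ketbra (pauliZ z) (pauliZ z) * ω (g : UGroup n) * Λ g := by
    rw [noisyFrameOperator, avg_eq_sum, Finset.sum_comm, Finset.smul_sum (r := ((2 : ℂ) ^ n)⁻¹)]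
    simp only [measurement_eq, mul_smul_comm, smul_mul_assoc, Finset.mul_sum, Finset.sum_mul]
  rw [hL, ← Fintype.sum_subtype_add_sum_subtype (fun z : Bits n => z ≠ 0), h1]
  have h2 : ∑ z : {z : Bits n // ¬ z ≠ 0}, ∑ g : Clifford n,
      ωAdj (g : UGroup n) * ketbra (pauliZ z.1) (pauliZ z.1) * ω (g : UGroup n) * Λ g =
        (Fintype.card (Clifford n) : ℂ) • ketbra (1 : Op n) 1 := by
    have : Unique {z : Bits n // ¬ z ≠ 0} :=
      ⟨⟨⟨0, by simp⟩⟩, fun z => Subtype.ext (not_not.mp z.2)⟩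
    rw [Fintype.sum_unique, ← h0]
    rw [not_not.mp (default : {z : Bits n // ¬ z ≠ 0}).2]
  rw [h2, add_comm, smul_add, smul_add, smul_comm _ ((2 : ℂ) ^ n)⁻¹, inv_smul_smul₀ hG,
    ketbra_normalized, ← Finset.sum_subtype_eq_sum_filter]
  congr 1
  simp only [avg_eq_sum, ketbra_normalized, ← Finset.smul_sum, mul_smul_comm, smul_mul_assoc,
    smul_smul, card_clifford, card_𝒩]
  have huniv : Finset.subtype (fun a : PauliLabel n => a ≠ 0) Finset.univ = Finset.univ := by
    ext; simp
  rw [huniv]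
  -- Only constants remain: in `|Cl_n| = (2ⁿ - 1)(2ⁿ + 1)|St_{e₁}|` the first and last factors
  -- normalize the two averages, leaving `(2ⁿ + 1)⁻¹`, and `2⁻ⁿ` normalizes the Paulis.
  congr 1
  simp only [mul_inv]
  ring

end CliffordShadow

theorem mainTheorem10 (n : ℕ) [NeZero n] :
    -- the Clifford group is finite, so that uniform averages over it and its subsets make sense
    Finite (Clifford n) ∧
    -- elements `g_a` as below exist for all `a ≠ 0`
    (∀ a : PauliLabel n, a ≠ 0 → ∃ g : Clifford n,
      ωAdj (g : UGroup n) * ketbra (Z₁ n) (Z₁ n) * ω (g : UGroup n) =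
        ketbra (pauli a) (pauli a)) ∧
    ∀ Λ : Clifford n → SuperOp n, (∀ g, IsChannel (Λ g)) →
      ∀ γ : PauliLabel n → Clifford n,
        (∀ a, a ≠ 0 →
          ωAdj (γ a : UGroup n) * ketbra (Z₁ n) (Z₁ n) * ω (γ a : UGroup n) =
            ketbra (pauli a) (pauli a)) →
        noisyFrameOperator Λ =
          ketbra (normalized (1 : Op n)) (normalized (1 : Op n)) +
            ((2 : ℂ) ^ n + 1)⁻¹ •
              ∑ a ∈ Finset.univ.filter (fun a : PauliLabel n => a ≠ 0),
                ketbra (normalized (pauli a)) (normalized (pauli a)) *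
                  avg (fun h : 𝒩 n => avg (fun h' : St n =>
                    Λ ((h : Clifford n)⁻¹ * (h' : Clifford n) * γ a))) :=
  ⟨finite_clifford n, fun _ ha => exists_ketbraConj_eq ha,
    fun _ hΛ _ hγ => noisyFrameOperator_eq hΛ hγ⟩
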